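/- **Setting.** Consider $M$ access points (APs) with $N$ antennas each and $K$ single-antenna users (UEs). A coherence block has $\tau_c=\tau_p+\tau_u+\tau_d$ channel uses, for uplink pilots, uplink data and downlink data. UE $l$ has uplink power $p_l\ge 0$, the noise power is $\sigma^2\ge 0$, each UE uses one of $\tau_p$ orthogonal pilots, and $\mathcal P_k$ is the set of UEs using the same pilot as UE $k$ (including $k$). The channels are spatially correlated Rician: $\mathbf g_{mk}=\bar{\mathbf g}_{mk}+\check{\mathbf g}_{mk}\in\mathbb C^N$ with $\bar{\mathbf g}_{mk}$ deterministic (LoS) and $\check{\mathbf g}_{mk}\sim\mathcal N_{\mathbb C}(\mathbf 0,\check{\mathbf R}_{mk})$ circularly symmetric (NLoS). The despread pilot signal is $\mathbf y^p_{mk}=\sum_{l\in\mathcal P_k}\sqrt{p_l}\,\tau_p\,\mathbf g_{ml}+\mathbf n^p_{mk}$ with $\mathbf n^p_{mk}\sim\mathcal N_{\mathbb C}(\mathbf 0,\tau_p\sigma^2\mathbf I_N)$; for each $k$, all the $\check{\mathbf g}_{ml}$ and the $\mathbf n^p_{mk}$ ($1\le m\le M$) are mutually independent. Put $\bar{\mathbf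 y}^p_{mk}=\sum_{l\in\mathcal P_k}\sqrt{p_l}\,\tau_p\,\bar{\mathbf g}_{ml}$ and $\mathbf\Psi_{mk}=\sum_{l\in\mathcal P_k}p_l\tau_p\check{\mathbf R}_{ml}+\sigma^2\mathbf I_N$. For arbitrary deterministic matrices $\mathbf A_{mk},\mathbf W_{mk}\in\mathbb C^{N\times N}$ let $\hat{\mathbf g}_{mk}=\bar{\mathbf g}_{mk}+\mathbf A_{mk}(\mathbf y^p_{mk}-\bar{\mathbf y}^p_{mk})$ and $\mathbf v_{mk}=\mathbf W_{mk}\hat{\mathbf g}_{mk}$. The use-and-then-forget SINR and spectral efficiency of UE $k$ are $$\mathrm{SINR}^{\mathrm{ul}}_k=\frac{p_k\left|\sum_{m=1}^M\mathbb E\{\mathbf v_{mk}^H\mathbf g_{mk}\}\right|^2}{\sum_{l=1}^Kp_l\,\mathbb E\left\{\left|\sum_{m=1}^M\mathbf v_{mk}^H\mathbf g_{ml}\right|^2\right\}-p_k\left|\sum_{m=1}^M\mathbb E\{\mathbf v_{mk}^H\mathbf g_{mk}\}\right|^2+\sigma^2\sum_{m=1}^M\mathbb E\{\|\mathbf v_{mk}\|^2\}},\qquad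 \mathrm{SE}^{\mathrm{ul}}_k=\frac{\tau_u}{\tau_c}\log_2\left(1+\mathrm{SINR}^{\mathrm{ul}}_k\right).$$ **Theorem.** For every UE $k$ all these expectations exist, and (reading a quotient with denominator $0$ as $0$ on both sides) $\mathrm{SINR}^{\mathrm{ul}}_k=\overline{\mathrm{SINR}}^{\mathrm{ul}}_k$, hence $\mathrm{SE}^{\mathrm{ul}}_k=\frac{\tau_u}{\tau_c}\log_2(1+\overline{\mathrm{SINR}}^{\mathrm{ul}}_k)$, where $\overline{\mathrm{SINR}}^{\mathrm{ul}}_k$ is the quotient with numerator $$p_k\left|\sum_{m=1}^M\mathrm{tr}(\mathbf W_{mk}^H\bar{\mathbf R}_{mk})\right|^2$$ and denominator $$\sum_{l=1}^K\sum_{m=1}^Mp_l\varepsilon_{mkl}+\sum_{l\in\mathcal P_k}\sum_{m=1}^Mp_l\xi_{mkl}+\sum_{l=1}^Kp_l\left(\left|\sum_{m=1}^M\chi_{mkl}\right|^2-\sum_{m=1}^M|\chi_{mkl}|^2\right)-p_k\left|\sum_{m=1}^M\mathrm{tr}(\mathbf W_{mk}^H\bar{\mathbf R}_{mk})\right|^2+\sigma^2\sum_{m=1}^M\mathrm{tr}\left(\mathbf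 W_{mk}^H\mathbf W_{mk}\left(\bar{\mathbf G}_{mkk}+\tau_p\mathbf A_{mk}\mathbf\Psi_{mk}\mathbf A_{mk}^H\right)\right).$$ Here $\bar{\mathbf G}_{mkl}=\bar{\mathbf g}_{mk}\bar{\mathbf g}_{ml}^H$, $\bar{\mathbf R}_{mk}=\bar{\mathbf G}_{mkk}+\sqrt{p_k}\,\tau_p\check{\mathbf R}_{mk}\mathbf A_{mk}^H$, $\mathbf B_{mlk}=\bar{\mathbf G}_{mlk}+\sqrt{p_l}\,\tau_p\check{\mathbf R}_{ml}\mathbf A_{mk}^H$, $$\varepsilon_{mkl}=\mathrm{tr}(\mathbf W_{mk}^H\bar{\mathbf G}_{mll}\mathbf W_{mk}\bar{\mathbf G}_{mkk})+\mathrm{tr}(\mathbf W_{mk}^H\check{\mathbf R}_{ml}\mathbf W_{mk}\bar{\mathbf G}_{mkk})+\tau_p\mathrm{tr}(\mathbf W_{mk}^H\bar{\mathbf G}_{mll}\mathbf W_{mk}\mathbf A_{mk}\mathbf\Psi_{mk}\mathbf A_{mk}^H)+\tau_p\mathrm{tr}(\mathbf W_{mk}^H\check{\mathbf R}_{ml}\mathbf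 W_{mk}\mathbf A_{mk}\mathbf\Psi_{mk}\mathbf A_{mk}^H),$$ $$\xi_{mkl}=\sqrt{p_l}\,\tau_p\mathrm{tr}(\mathbf W_{mk}^H\bar{\mathbf G}_{mlk})\,\mathrm{tr}(\mathbf W_{mk}\mathbf A_{mk}\check{\mathbf R}_{ml})+\sqrt{p_l}\,\tau_p\mathrm{tr}(\mathbf W_{mk}^H\check{\mathbf R}_{ml}\mathbf A_{mk}^H)\,\mathrm{tr}(\mathbf W_{mk}\bar{\mathbf G}_{mkl})+p_l\tau_p^2\left|\mathrm{tr}(\mathbf W_{mk}^H\check{\mathbf R}_{ml}\mathbf A_{mk}^H)\right|^2,$$ and $\chi_{mkl}=\mathrm{tr}(\mathbf W_{mk}^H\mathbf B_{mlk})$ if $l\in\mathcal P_k$, $\chi_{mkl}=\mathrm{tr}(\mathbf W_{mk}^H\bar{\mathbf G}_{mlk})$ if $l\notin\mathcal P_k$. Moreover, if $\sqrt{p_k}\,\check{\mathbf R}_{mk}\mathbf A_{mk}^H=\mathbf A_{mk}\mathbf\Psi_{mk}\mathbf A_{mk}^H$ for all $m$ (for instance for the MMSE estimator $\mathbf A_{mk}=\sqrt{p_k}\,\check{\mathbf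 R}_{mk}\mathbf\Psi_{mk}^{-1}$), both formulas hold with the last term of the denominator written as $\sigma^2\sum_{m=1}^M\mathrm{tr}(\mathbf W_{mk}^H\mathbf W_{mk}\bar{\mathbf R}_{mk})$. -/

import Mathlib

open MeasureTheory ProbabilityTheory Matrix
open scoped ComplexOrder

noncomputable section

namespace CellFree

/-- The law of `z` under `P` is the circularly symmetric complex Gaussian distribution with mean
`μ` and covariance matrix `R`: `z` is jointly Gaussian (over `ℝ`), has mean `μ`, covariance
`E[(z - μ)(z - μ)ᴴ] = R` and vanishing pseudo-covariance `E[(z - μ)(z - μ)ᵀ] = 0`. All moments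
exist because the law is Gaussian. -/
structure IsComplexGaussian {Ω : Type*} [MeasurableSpace Ω] {N : ℕ} (P : Measure Ω)
    (z : Ω → Fin N → ℂ) (μ : Fin N → ℂ) (R : Matrix (Fin N) (Fin N) ℂ) : Prop where
  gaussian : HasGaussianLaw z P
  mean : ∀ i, ∫ ω, z ω i ∂P = μ i
  covariance : ∀ i j, ∫ ω, (z ω i - μ i) * star (z ω j - μ j) ∂P = R i j
  pseudoCovariance : ∀ i j, ∫ ω, (z ω i - μ i) * (z ω j - μ j) ∂P = 0

/-- The deterministic data of an uplink cell-free network with `M` access points (APs) of `N`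
antennas each and `K` single-antenna users (UEs). -/
structure Network (M N K : ℕ) where
  /-- channel uses per coherence block for uplink pilots (also the number of pilots) -/
  τp : ℕ
  /-- channel uses per coherence block for uplink data -/
  τu : ℕ
  /-- channel uses per coherence block for downlink data -/
  τd : ℕ
  /-- index of the pilot signal used by each UE -/
  pilot : Fin K → Fin τp
  /-- uplink transmit powers -/
  p : Fin K → ℝ
  p_nonneg : ∀ k, 0 ≤ p k
  /-- noise power -/
  σ2 : ℝ
  σ2_nonneg : 0 ≤ σ2
  /-- line-of-sight (LoS) components of the channels -/
  los : Fin M → Fin K → Fin N → ℂ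
  /-- covariance matrices of the non-line-of-sight (NLoS) components -/
  R : Fin M → Fin K → Matrix (Fin N) (Fin N) ℂ
  R_posSemidef : ∀ m k, (R m k).PosSemidef
  /-- matrices of the linear channel estimators -/
  A : Fin M → Fin K → Matrix (Fin N) (Fin N) ℂ
  /-- matrices of the bilinear equalizers -/
  W : Fin M → Fin K → Matrix (Fin N) (Fin N) ℂ

namespace Network

variable {M N K : ℕ} (net : Network M N K) {Ω : Type*}

/-- Length of a coherence block. -/
def τc : ℕ := net.τp + net.τu + net.τd

/-- The UEs that use the same pilot as UE `k`, including `k` itself. -/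
def P (k : Fin K) : Finset (Fin K) := Finset.univ.filter fun l => net.pilot l = net.pilot k

/-! ### The random model -/

/-- The joint law of the NLoS components `h m k` and of the despread pilot noises `n m k`.
The noises of UEs that share a pilot need not be independent of each other (they may coincide):
for each UE `k`, all NLoS components and the noises `n m k` at the `M` APs are independent. -/
structure IsFading [MeasurableSpace Ω] (Pr : Measure Ω)
    (h n : Fin M → Fin K → Ω → Fin N → ℂ) : Prop where
  nlos : ∀ m k, IsComplexGaussian Pr (h m k) 0 (net.R m k)
  noise : ∀ m k, IsComplexGaussian Pr (n m k) 0
    (((net.τp * net.σ2 : ℝ) : ℂ) • (1 : Matrix (Fin N) (Fin N) ℂ))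
  indep : ∀ k, iIndepFun
    (Sum.elim (fun ml : Fin M × Fin K => h ml.1 ml.2) (fun m : Fin M => n m k)) Pr

/-- Rician channel `g_mk`: LoS component plus NLoS component. -/
def channel (h : Fin M → Fin K → Ω → Fin N → ℂ) (m : Fin M) (k : Fin K) (ω : Ω) : Fin N → ℂ :=
  net.los m k + h m k ω

/-- Received pilot signal `y_mk` after despreading. -/
def pilotSignal (h n : Fin M → Fin K → Ω → Fin N → ℂ) (m : Fin M) (k : Fin K) (ω : Ω) :
    Fin N → ℂ :=
  ∑ l ∈ net.P k, ((√(net.p l) * net.τp : ℝ) : ℂ) • net.channel h m l ω + n m k ω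

/-- Deterministic part of the received pilot signal. -/
def pilotMean (m : Fin M) (k : Fin K) : Fin N → ℂ :=
  ∑ l ∈ net.P k, ((√(net.p l) * net.τp : ℝ) : ℂ) • net.los m l

/-- Linear channel estimate `ĝ_mk`. -/
def estimate (h n : Fin M → Fin K → Ω → Fin N → ℂ) (m : Fin M) (k : Fin K) (ω : Ω) :
    Fin N → ℂ :=
  net.los m k + net.A m k *ᵥ (net.pilotSignal h n m k ω - net.pilotMean m k)

/-- Bilinear-equalizer combining vector `v_mk = W_mk ĝ_mk`. -/
def combiner (h n : Fin M → Fin K → Ω → Fin N → ℂ) (m : Fin M) (k : Fin K) (ω : Ω) :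
    Fin N → ℂ :=
  net.W m k *ᵥ net.estimate h n m k ω

/-- `v_mkᴴ g_ml`. -/
def combined (h n : Fin M → Fin K → Ω → Fin N → ℂ) (m : Fin M) (k l : Fin K) (ω : Ω) : ℂ :=
  star (net.combiner h n m k ω) ⬝ᵥ net.channel h m l ω

/-- Euclidean norm squared `‖v_mk‖²`. -/
def combinerNormSq (h n : Fin M → Fin K → Ω → Fin N → ℂ) (m : Fin M) (k : Fin K) (ω : Ω) : ℝ :=
  ‖WithLp.toLp 2 (net.combiner h n m k ω)‖ ^ 2

/-- Use-and-then-forget SINR of UE `k`, for the combining vectors `v_mk = W_mk ĝ_mk`. -/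
def sinr [MeasurableSpace Ω] (Pr : Measure Ω) (h n : Fin M → Fin K → Ω → Fin N → ℂ)
    (k : Fin K) : ℝ :=
  (net.p k * ‖∑ m, ∫ ω, net.combined h n m k k ω ∂Pr‖ ^ 2) /
    (∑ l, net.p l * ∫ ω, ‖∑ m, net.combined h n m k l ω‖ ^ 2 ∂Pr
      - net.p k * ‖∑ m, ∫ ω, net.combined h n m k k ω ∂Pr‖ ^ 2
      + net.σ2 * ∑ m, ∫ ω, net.combinerNormSq h n m k ω ∂Pr)

/-- Spectral efficiency `(τ_u / τ_c) log₂ (1 + s)` at effective SINR `s`. -/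
def se (s : ℝ) : ℝ := (net.τu / net.τc : ℝ) * Real.logb 2 (1 + s)

/-! ### The closed form -/

/-- `√p_l τ_p` as a complex number. -/
def amp (l : Fin K) : ℂ := ((√(net.p l) * net.τp : ℝ) : ℂ)

/-- `Ψ_mk`; the covariance matrix of `y_mk` is `τ_p Ψ_mk`. -/
def Ψ (m : Fin M) (k : Fin K) : Matrix (Fin N) (Fin N) ℂ :=
  ∑ l ∈ net.P k, ((net.p l * net.τp : ℝ) : ℂ) • net.R m l
    + (net.σ2 : ℂ) • (1 : Matrix (Fin N) (Fin N) ℂ)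

/-- LoS outer product `Ḡ_mkl = ḡ_mk ḡ_mlᴴ`. -/
def G (m : Fin M) (k l : Fin K) : Matrix (Fin N) (Fin N) ℂ :=
  vecMulVec (net.los m k) (star (net.los m l))

/-- `R̄_mk = Ḡ_mkk + √p_k τ_p Ř_mk A_mkᴴ`. -/
def Rbar (m : Fin M) (k : Fin K) : Matrix (Fin N) (Fin N) ℂ :=
  net.G m k k + net.amp k • (net.R m k * (net.A m k)ᴴ)

/-- `B_mlk = Ḡ_mlk + √p_l τ_p Ř_ml A_mkᴴ`. -/
def B (m : Fin M) (l k : Fin K) : Matrix (Fin N) (Fin N) ℂ :=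
  net.G m l k + net.amp l • (net.R m l * (net.A m k)ᴴ)

/-- `τ_p A_mk Ψ_mk A_mkᴴ`, the covariance matrix of the estimate `ĝ_mk`. -/
def estCov (m : Fin M) (k : Fin K) : Matrix (Fin N) (Fin N) ℂ :=
  (net.τp : ℂ) • (net.A m k * net.Ψ m k * (net.A m k)ᴴ)

def ε (m : Fin M) (k l : Fin K) : ℂ :=
  trace ((net.W m k)ᴴ * net.G m l l * net.W m k * net.G m k k)
    + trace ((net.W m k)ᴴ * net.R m l * net.W m k * net.G m k k)
    + net.τp * trace ((net.W m k)ᴴ * net.G m l l * net.W m k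
        * (net.A m k * net.Ψ m k * (net.A m k)ᴴ))
    + net.τp * trace ((net.W m k)ᴴ * net.R m l * net.W m k
        * (net.A m k * net.Ψ m k * (net.A m k)ᴴ))

def ξ (m : Fin M) (k l : Fin K) : ℂ :=
  net.amp l * trace ((net.W m k)ᴴ * net.G m l k) * trace (net.W m k * net.A m k * net.R m l)
    + net.amp l * trace ((net.W m k)ᴴ * net.R m l * (net.A m k)ᴴ)
        * trace (net.W m k * net.G m k l)
    + ((net.p l * (net.τp : ℝ) ^ 2
        * ‖trace ((net.W m k)ᴴ * net.R m l * (net.A m k)ᴴ)‖ ^ 2 : ℝ) : ℂ)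

def χ (m : Fin M) (k l : Fin K) : ℂ :=
  if l ∈ net.P k then trace ((net.W m k)ᴴ * net.B m l k)
  else trace ((net.W m k)ᴴ * net.G m l k)

/-- The closed-form SINR, with the receiver-noise term `σ² ∑ₘ tr (W_mkᴴ W_mk Q_m)`. -/
def closedSinrWith (Q : Fin M → Matrix (Fin N) (Fin N) ℂ) (k : Fin K) : ℂ :=
  ((net.p k * ‖∑ m, trace ((net.W m k)ᴴ * net.Rbar m k)‖ ^ 2 : ℝ) : ℂ) /
    (∑ l, ∑ m, (net.p l : ℂ) * net.ε m k l
      + ∑ l ∈ net.P k, ∑ m, (net.p l : ℂ) * net.ξ m k l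
      + ((∑ l, net.p l * (‖∑ m, net.χ m k l‖ ^ 2 - ∑ m, ‖net.χ m k l‖ ^ 2) : ℝ) : ℂ)
      - ((net.p k * ‖∑ m, trace ((net.W m k)ᴴ * net.Rbar m k)‖ ^ 2 : ℝ) : ℂ)
      + (net.σ2 : ℂ) * ∑ m, trace ((net.W m k)ᴴ * net.W m k * Q m))

/-- The closed-form SINR for arbitrary estimator matrices; in the noise term stands
`E[ĝ_mk ĝ_mkᴴ] = Ḡ_mkk + τ_p A_mk Ψ_mk A_mkᴴ`. -/
def closedSinr (k : Fin K) : ℂ :=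
  net.closedSinrWith (fun m => net.G m k k + net.estCov m k) k

/-- The variant of the closed form that has `R̄_mk = E[g_mk ĝ_mkᴴ]` in the noise term. -/
def closedSinrRbar (k : Fin K) : ℂ :=
  net.closedSinrWith (fun m => net.Rbar m k) k

end Network

end CellFree

end

/-! Fix the UE `k`. Every combining vector and every channel is an affine function of independent
centred circular Gaussian vectors: the NLoS components and the noises `n m k`. The SINR therefore
involves only moments of order at most four. For `v = a + b` and `g = c + d` with deterministic `a`,
`c`, the moment `E[(vᴴ g)(v'ᴴ g')*]` is the product of the two means plus three terms built from
`E[b' bᴴ]` and `E[d d'ᴴ]`: Isserlis' theorem reduces fourth moments to pairings, odd moments vanish,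
and circularity kills every pairing of two unconjugated or two conjugated factors
(`IsCircular.map_affineInner_mul_star`). Distinct APs are uncorrelated, so for `m ≠ m'` this moment
is just `χ m * star (χ m')`. Only the diagonal carries the covariance terms, and `ε_add_ξ` rewrites
these in the stated closed form. The computation takes place in the star-algebra `allMoments`, where
the expectation is a linear functional. Integrability is thus membership in the algebra and needs no
check term by term. -/

section GaussianMoments

/-! ### Third and fourth moments of a real Gaussian -/

/-- The first moments of a centred real Gaussian random variable. -/
theorem ProbabilityTheory.HasGaussianLaw.moments_of_centered {Ω : Type*} [MeasurableSpace Ω]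
    {P : Measure Ω} {X : Ω → ℝ} (hX : HasGaussianLaw X P) (h0 : ∫ ω, X ω ∂P = 0) :
    ∫ ω, X ω ^ 3 ∂P = 0 ∧ ∫ ω, X ω ^ 4 ∂P = 3 * (∫ ω, X ω ^ 2 ∂P) ^ 2 := by
  have hlaw := hX.map_eq_gaussianReal
  rw [h0] at hlaw
  set v := Var[X; P].toNNReal
  have hmgf := mgf_gaussianReal hlaw
  have hset : integrableExpSet X P = Set.univ := by
    refine Set.eq_univ_of_forall fun t => ?_
    have := integrable_exp_mul_gaussianReal (μ := 0) (v := v) t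
    rw [← hlaw] at this
    exact this.comp_aemeasurable hX.aemeasurable
  have hint : ∀ t, t ∈ interior (integrableExpSet X P) := by simp [hset]
  -- `m n` is the `n`-th derivative of the moment generating function. Each is a polynomial `q`
  -- times `exp (v t² / 2)`, and differentiating replaces `q` by `q' + q v t`; the moments are the
  -- values at `t = 0`.
  let m : ℕ → ℝ → ℝ := fun n t => ∫ ω, X ω ^ n * Real.exp (t * X ω) ∂P
  have hd : ∀ n t, HasDerivAt (m n) (m (n + 1) t) t := fun n t =>
    hasDerivAt_integral_pow_mul_exp_real (hint t) n
  have he : ∀ t : ℝ, HasDerivAt (fun t : ℝ => Real.exp (v * t ^ 2 / 2))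
      (v * t * Real.exp (v * t ^ 2 / 2)) t := fun t => by
    have h1 : HasDerivAt (fun t : ℝ => (v : ℝ) * t ^ 2 / 2) (v * t) t := by
      convert! (((hasDerivAt_id t).pow 2).const_mul (v : ℝ)).div_const 2 using 1
      simp; ring
    simpa [mul_comm] using h1.exp
  have key : ∀ (n : ℕ) (q q' : ℝ → ℝ), (∀ t, HasDerivAt q (q' t) t) →
      (∀ t, m n t = q t * Real.exp (v * t ^ 2 / 2)) →
      ∀ t, m (n + 1) t = (q' t + q t * (v * t)) * Real.exp (v * t ^ 2 / 2) := by
    intro n q q' hq hm t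
    have h1 := hd n t
    rw [show m n = fun t => q t * Real.exp (v * t ^ 2 / 2) from funext hm] at h1
    rw [h1.unique ((hq t).mul (he t))]
    ring
  have m0 : ∀ t, m 0 t = 1 * Real.exp (v * t ^ 2 / 2) := fun t => by
    have := hmgf t
    simpa [m, mgf] using this
  have m1 := key 0 (fun _ => 1) (fun _ => 0) (fun t => hasDerivAt_const t 1) m0
  have m2 := key 1 (fun t => v * t) (fun _ => v) (fun t => by
    simpa using (hasDerivAt_id t).const_mul (v : ℝ)) (fun t => by simp [m1 t])
  have m3 := key 2 (fun t => v + v ^ 2 * t ^ 2) (fun t => 2 * v ^ 2 * t) (fun t => by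
    convert! ((hasDerivAt_id t).pow 2).const_mul ((v : ℝ) ^ 2) |>.const_add (v : ℝ) using 1
    simp; ring) (fun t => by rw [m2 t]; ring)
  have m4 := key 3 (fun t => 3 * v ^ 2 * t + v ^ 3 * t ^ 3) (fun t => 3 * v ^ 2 + 3 * v ^ 3 * t ^ 2)
    (fun t => by
      convert! ((hasDerivAt_id t).const_mul (3 * (v : ℝ) ^ 2)).add
        (((hasDerivAt_id t).pow 3).const_mul ((v : ℝ) ^ 3)) using 1
      simp; ring) (fun t => by rw [m3 t]; ring)
  have h2 : ∫ ω, X ω ^ 2 ∂P = v := by simpa [m] using m2 0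
  have h3 : ∫ ω, X ω ^ 3 ∂P = 0 := by simpa [m] using m3 0
  have h4 : ∫ ω, X ω ^ 4 ∂P = 3 * v ^ 2 := by simpa [m] using m4 0
  exact ⟨h3, by rw [h4, h2]⟩

end GaussianMoments

/-! ### The star-algebra of random variables with all moments -/

section AllMoments

variable {Ω : Type*} [MeasurableSpace Ω]

/-- The algebra of complex random variables with finite moments of all orders. -/
def allMoments (P : Measure Ω) [IsFiniteMeasure P] : StarSubalgebra ℂ (Ω → ℂ) where
  carrier := {f | ∀ p : ENNReal, p ≠ ⊤ → MemLp f p P}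
  mul_mem' := fun hf hg p hp => by
    -- Hölder: a product of two functions in `L^{2p}` lies in `L^p`, so finiteness of all moments is
    -- stable under products.
    have : ENNReal.HolderTriple (2 * p) (2 * p) p := ⟨by
      rw [ENNReal.mul_inv (by simp) (by simp), ← add_mul, ENNReal.inv_two_add_inv_two, one_mul]⟩
    have h2 : 2 * p ≠ ⊤ := ENNReal.mul_ne_top (by simp) hp
    exact (hg _ h2).mul (hf _ h2)
  add_mem' := fun hf hg p hp => (hf p hp).add (hg p hp)
  algebraMap_mem' := fun r p _ => memLp_const r
  star_mem' := fun hf p hp => (hf p hp).star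

variable {P : Measure Ω} [IsFiniteMeasure P]

theorem allMoments.integrable (f : allMoments P) : Integrable (f : Ω → ℂ) P :=
  memLp_one_iff_integrable.1 (f.2 1 (by simp))

/-- The expectation on the algebra of random variables with moments of all orders. -/
noncomputable def expectation (P : Measure Ω) [IsFiniteMeasure P] : allMoments P →ₗ[ℂ] ℂ where
  toFun f := ∫ ω, (f : Ω → ℂ) ω ∂P
  map_add' f g := integral_add (allMoments.integrable f) (allMoments.integrable g)
  map_smul' c _ := integral_const_mul c _

theorem expectation_apply (f : allMoments P) :
    expectation P f = ∫ ω, (f : Ω → ℂ) ω ∂P := rfl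

theorem expectation_star (f : allMoments P) : expectation P (star f) = star (expectation P f) :=
  integral_conj

theorem expectation_one [IsProbabilityMeasure P] : expectation P 1 = 1 := by
  simp [expectation_apply]

end AllMoments

/-! ### Isserlis' theorem and circularity, in an abstract commutative algebra -/

section GaussianAlgebra

variable {A : Type*} [CommRing A] [Algebra ℂ A]

/-- Third moments vanish on a space whose elements have vanishing third moment. -/
theorem LinearMap.map_mul_mul_eq_zero (E : A →ₗ[ℂ] ℂ) (S : Submodule ℂ A)
    (h3 : ∀ f ∈ S, E (f ^ 3) = 0) {f g h : A} (hf : f ∈ S) (hg : g ∈ S) (hh : h ∈ S) :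
    E (f * g * h) = 0 := by
  -- Polarization over the signs of `g` and `h`, weighted by their product: four cubes, each
  -- contributing `3! = 6` times `f * g * h`.
  have e : (24 : ℂ) • (f * g * h) = (f + g + h) ^ 3 - (f + g - h) ^ 3 - (f - g + h) ^ 3
      + (f - g - h) ^ 3 := by
    rw [Algebra.smul_def, map_ofNat]; ring
  have := congrArg E e
  rw [map_smul, map_add, map_sub, map_sub, h3 _ (S.add_mem (S.add_mem hf hg) hh),
    h3 _ (S.sub_mem (S.add_mem hf hg) hh), h3 _ (S.add_mem (S.sub_mem hf hg) hh),
    h3 _ (S.sub_mem (S.sub_mem hf hg) hh)] at this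
  simpa using this

/-- Isserlis' theorem for fourth moments, by polarization. -/
theorem LinearMap.map_mul_mul_mul (E : A →ₗ[ℂ] ℂ) (S : Submodule ℂ A)
    (h4 : ∀ f ∈ S, E (f ^ 4) = 3 * E (f ^ 2) ^ 2) {f g h k : A} (hf : f ∈ S) (hg : g ∈ S)
    (hh : h ∈ S) (hk : k ∈ S) :
    E (f * g * h * k) = E (f * g) * E (h * k) + E (f * h) * E (g * k) + E (f * k) * E (g * h) := by
  -- Eight sign patterns, each contributing `4! = 24` copies of the product; all other monomials
  -- cancel.
  have e : (192 : ℂ) • (f * g * h * k) =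
      (f + g + h + k) ^ 4 - (f + g + h - k) ^ 4 - (f + g - h + k) ^ 4 + (f + g - h - k) ^ 4
      - (f - g + h + k) ^ 4 + (f - g + h - k) ^ 4 + (f - g - h + k) ^ 4 - (f - g - h - k) ^ 4 := by
    rw [Algebra.smul_def, map_ofNat]; ring
  have sq : ∀ s t u : ℂ, E ((f + s • g + t • h + u • k) ^ 2) = E (f ^ 2) + s ^ 2 * E (g ^ 2)
      + t ^ 2 * E (h ^ 2) + u ^ 2 * E (k ^ 2) + 2 * (s * E (f * g) + t * E (f * h) + u * E (f * k)
      + s * t * E (g * h) + s * u * E (g * k) + t * u * E (h * k)) := by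
    intro s t u
    have : (f + s • g + t • h + u • k) ^ 2 = f ^ 2 + s ^ 2 • g ^ 2
      + t ^ 2 • h ^ 2 + u ^ 2 • k ^ 2 + (2 : ℂ) • (s • (f * g) + t • (f * h) + u • (f * k)
      + (s * t) • (g * h) + (s * u) • (g * k) + (t * u) • (h * k)) := by
      simp only [Algebra.smul_def, map_ofNat, map_mul, map_pow]; ring
    rw [this]
    simp only [map_add, map_smul, smul_eq_mul]
  have q : ∀ s t u : ℂ, E ((f + s • g + t • h + u • k) ^ 4) = 3 * (E (f ^ 2) + s ^ 2 * E (g ^ 2)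
      + t ^ 2 * E (h ^ 2) + u ^ 2 * E (k ^ 2) + 2 * (s * E (f * g) + t * E (f * h) + u * E (f * k)
      + s * t * E (g * h) + s * u * E (g * k) + t * u * E (h * k))) ^ 2 := by
    intro s t u
    rw [h4 _ (S.add_mem (S.add_mem (S.add_mem hf (S.smul_mem s hg)) (S.smul_mem t hh))
      (S.smul_mem u hk)), sq]
  have := congrArg E e
  have q1 := q 1 1 1
  have q2 := q 1 1 (-1)
  have q3 := q 1 (-1) 1
  have q4 := q 1 (-1) (-1)
  have q5 := q (-1) 1 1
  have q6 := q (-1) 1 (-1)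
  have q7 := q (-1) (-1) 1
  have q8 := q (-1) (-1) (-1)
  simp only [one_smul, neg_smul, ← sub_eq_add_neg] at q1 q2 q3 q4 q5 q6 q7 q8
  simp only [map_smul, map_add, map_sub, smul_eq_mul] at this
  rw [q1, q2, q3, q4, q5, q6, q7, q8] at this
  linear_combination this / 192

variable [StarRing A] [StarModule ℂ A]

/-- `T` is a space of centred, jointly circularly symmetric complex Gaussian variables, as far as
the expectation `E` of products of at most four of them is concerned. -/
structure IsCircular (E : A →ₗ[ℂ] ℂ) (T : Submodule ℂ A) : Prop where
  one : E 1 = 1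
  map_star : ∀ f, E (star f) = star (E f)
  mean : ∀ f ∈ T, E f = 0
  pseudo : ∀ f ∈ T, ∀ g ∈ T, E (f * g) = 0
  third : ∀ f ∈ T, ∀ g ∈ T, ∀ h ∈ T, E (star f * g * h) = 0
  fourth : ∀ f ∈ T, ∀ g ∈ T, ∀ h ∈ T, ∀ k ∈ T,
    E (star f * g * (h * star k)) =
      E (star f * g) * E (h * star k) + E (star f * h) * E (g * star k)

-- `T` holds unconjugated variables and `S` is large enough to contain their conjugates too.
-- Polarization works in `S`, where squares need not have zero mean; vanishing pseudo-covariance on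
-- `T` then removes one of the three Isserlis pairings.
omit [StarModule ℂ A] in
theorem IsCircular.of_span {E : A →ₗ[ℂ] ℂ} {S T : Submodule ℂ A} (one : E 1 = 1)
    (map_star : ∀ f, E (star f) = star (E f)) (hTS : T ≤ S) (hstar : ∀ f ∈ T, star f ∈ S)
    (h1 : ∀ f ∈ S, E f = 0) (h3 : ∀ f ∈ S, E (f ^ 3) = 0)
    (h4 : ∀ f ∈ S, E (f ^ 4) = 3 * E (f ^ 2) ^ 2)
    (pseudo : ∀ f ∈ T, ∀ g ∈ T, E (f * g) = 0) : IsCircular E T where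
  one := one
  map_star := map_star
  mean f hf := h1 f (hTS hf)
  pseudo := pseudo
  third f hf g hg h hh := E.map_mul_mul_eq_zero S h3 (hstar f hf) (hTS hg) (hTS hh)
  fourth f hf g hg h hh k hk := by
    have e : E (star f * star k) = 0 := by
      rw [← star_mul', map_star, pseudo f hf k hk, star_zero]
    rw [← mul_assoc, E.map_mul_mul_mul S h4 (hstar f hf) (hTS hg) (hTS hh) (hstar k hk), e]
    ring

namespace IsCircular

variable {E : A →ₗ[ℂ] ℂ} {T : Submodule ℂ A} (hT : IsCircular E T)
include hT

omit [StarModule ℂ A] in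
theorem map_algebraMap (c : ℂ) : E (algebraMap ℂ A c) = c := by
  rw [Algebra.algebraMap_eq_smul_one, map_smul, hT.one, smul_eq_mul, mul_one]

omit [StarModule ℂ A] in
theorem third' {f g h : A} (hf : f ∈ T) (hg : g ∈ T) (hh : h ∈ T) :
    E (star f * g * star h) = 0 := by
  have := hT.third g hg f hf h hh
  rw [← star_eq_zero, ← hT.map_star] at this
  rw [← this]; congr 1; simp; ring

theorem map_product (a c : ℂ) {b d : A} (hb : b ∈ T) (hd : d ∈ T) :
    E (star (algebraMap ℂ A a + b) * (algebraMap ℂ A c + d)) = star a * c + E (star b * d) := by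
  have e : star (algebraMap ℂ A a + b) * (algebraMap ℂ A c + d) =
      algebraMap ℂ A (star a * c) + c • star b + star a • d + star b * d := by
    simp only [Algebra.smul_def, star_add, map_mul, algebraMap_star_comm]; ring
  rw [e]
  simp only [map_add, map_smul, smul_eq_mul, hT.map_algebraMap, hT.map_star, hT.mean _ hb,
    hT.mean _ hd, star_zero, mul_zero, add_zero]

/-- Mixed second moment of two products of (noncentral) circular Gaussian variables. -/
theorem map_product_mul_star_product (a c a' c' : ℂ) {b d b' d' : A} (hb : b ∈ T) (hd : d ∈ T)
    (hb' : b' ∈ T) (hd' : d' ∈ T) :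
    E (star (algebraMap ℂ A a + b) * (algebraMap ℂ A c + d)
        * star (star (algebraMap ℂ A a' + b') * (algebraMap ℂ A c' + d'))) =
      E (star (algebraMap ℂ A a + b) * (algebraMap ℂ A c + d))
        * star (E (star (algebraMap ℂ A a' + b') * (algebraMap ℂ A c' + d')))
      + (c * star c' * E (b' * star b) + star a * a' * E (d * star d')
        + E (b' * star b) * E (d * star d')) := by
  -- The sixteen monomials, each arranged so that one of the moment rules applies verbatim. Those
  -- with unequal numbers of conjugated and unconjugated random factors have expectation zero.
  have e : star (algebraMap ℂ A a + b) * (algebraMap ℂ A c + d)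
        * star (star (algebraMap ℂ A a' + b') * (algebraMap ℂ A c' + d')) =
      algebraMap ℂ A (star a * c * (a' * star c'))
      + (star a * c * star c') • b' + (star a * c * a') • star d'
      + (star a * c) • star (star b' * d')
      + (c * (a' * star c')) • star b + (c * star c') • (b' * star b) + (c * a') • star (b * d')
      + c • star (star b' * b * d')
      + (star a * (a' * star c')) • d + (star a * star c') • (d * b') + (star a * a') • (d * star d')
      + star a • (star d' * d * b')
      + (a' * star c') • (star b * d) + star c' • (star b * d * b') + a' • (star b * d * star d')
      + star b * d * (b' * star d') := by
    simp only [Algebra.smul_def, star_add, star_mul', map_mul, algebraMap_star_comm, star_star]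
    ring
  rw [hT.map_product a c hb hd, hT.map_product a' c' hb' hd', e]
  simp only [map_add, map_smul, smul_eq_mul, hT.map_algebraMap, hT.map_star, hT.mean _ hb,
    hT.mean _ hd, hT.mean _ hb', hT.mean _ hd', hT.pseudo _ hb _ hd', hT.pseudo _ hd _ hb',
    hT.third _ hb' _ hb _ hd', hT.third _ hd' _ hd _ hb', hT.third _ hb _ hd _ hb',
    hT.third' hb hd hd', hT.fourth _ hb _ hd _ hb' _ hd', star_zero]
  simp only [star_add, star_mul', star_star]
  rw [show star (E (star b' * d')) = E (b' * star d') by rw [← hT.map_star]; simp,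
    mul_comm (star b) b']
  ring

end IsCircular

end GaussianAlgebra

/-! ### Cross-covariance matrices and noncentral inner products -/

section CrossCovariance

variable {A : Type*} [CommRing A] [Algebra ℂ A] [StarRing A] {ι κ : Type*}

/-- The matrix `E[x yᴴ]` of mixed second moments. -/
def crossCov (E : A →ₗ[ℂ] ℂ) (x y : ι → A) : Matrix ι ι ℂ := .of fun i j => E (x i * star (y j))

/-- The random vector `D x` for a deterministic matrix `D`. -/
def matSmul [Fintype ι] (D : Matrix ι ι ℂ) (x : ι → A) : ι → A := fun i => ∑ j, D i j • x j

/-- The inner product `(a + b)ᴴ (c + d)` with deterministic vectors `a` and `c`. -/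
def affineInner [Fintype ι] (a c : ι → ℂ) (b d : ι → A) : A :=
  ∑ i, star (algebraMap ℂ A (a i) + b i) * (algebraMap ℂ A (c i) + d i)

omit [StarRing A] in
theorem matSmul_mem [Fintype ι] {T : Submodule ℂ A} {x : ι → A} (D : Matrix ι ι ℂ)
    (hx : ∀ i, x i ∈ T) (i : ι) : matSmul D x i ∈ T :=
  T.sum_mem fun j _ => T.smul_mem _ (hx j)

variable {E : A →ₗ[ℂ] ℂ}

theorem crossCov_add_left (x x' y : ι → A) :
    crossCov E (x + x') y = crossCov E x y + crossCov E x' y := by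
  ext; simp [crossCov, add_mul]

theorem crossCov_add_right (x y y' : ι → A) :
    crossCov E x (y + y') = crossCov E x y + crossCov E x y' := by
  ext; simp [crossCov, mul_add]

theorem crossCov_sum_left (s : Finset κ) (x : κ → ι → A) (y : ι → A) :
    crossCov E (∑ l ∈ s, x l) y = ∑ l ∈ s, crossCov E (x l) y := by
  ext; simp [crossCov, Finset.sum_mul, Matrix.sum_apply]

theorem crossCov_sum_right (s : Finset κ) (x : ι → A) (y : κ → ι → A) :
    crossCov E x (∑ l ∈ s, y l) = ∑ l ∈ s, crossCov E x (y l) := by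
  ext; simp [crossCov, Finset.mul_sum, Matrix.sum_apply]

theorem crossCov_smul_left (c : ℂ) (x y : ι → A) :
    crossCov E (c • x) y = c • crossCov E x y := by
  ext; simp [crossCov]

theorem crossCov_matSmul_left [Fintype ι] (D : Matrix ι ι ℂ) (x y : ι → A) :
    crossCov E (matSmul D x) y = D * crossCov E x y := by
  ext; simp [crossCov, matSmul, Matrix.mul_apply, Finset.sum_mul]

variable [StarModule ℂ A]

theorem crossCov_smul_right (c : ℂ) (x y : ι → A) :
    crossCov E x (c • y) = star c • crossCov E x y := by
  ext; simp [crossCov]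

theorem crossCov_matSmul_right [Fintype ι] (D : Matrix ι ι ℂ) (x y : ι → A) :
    crossCov E x (matSmul D y) = crossCov E x y * Dᴴ := by
  ext; simp [crossCov, matSmul, Matrix.mul_apply, Finset.mul_sum, mul_comm]

namespace IsCircular

variable {T : Submodule ℂ A} (hT : IsCircular E T) [Fintype ι] {b d b' d' : ι → A}
include hT

theorem map_affineInner (a c : ι → ℂ) (hb : ∀ i, b i ∈ T) (hd : ∀ i, d i ∈ T) :
    E (affineInner a c b d) = trace (vecMulVec c (star a) + crossCov E d b) := by
  simp only [affineInner, map_sum, trace, diag_apply, Matrix.add_apply, vecMulVec_apply, crossCov,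
    of_apply, Pi.star_apply]
  refine Finset.sum_congr rfl fun i _ => ?_
  rw [hT.map_product _ _ (hb i) (hd i), mul_comm (c i), mul_comm (d i)]

/-- The scalar moment formula summed over pairs of coordinates `(i, j)`: each double sum of products
of matrix entries is the trace of a matrix product. -/
theorem map_affineInner_mul_star (a c a' c' : ι → ℂ) (hb : ∀ i, b i ∈ T) (hd : ∀ i, d i ∈ T)
    (hb' : ∀ i, b' i ∈ T) (hd' : ∀ i, d' i ∈ T) :
    E (affineInner a c b d * star (affineInner a' c' b' d')) =
      E (affineInner a c b d) * star (E (affineInner a' c' b' d'))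
      + (trace (vecMulVec c (star c') * crossCov E b' b)
        + trace (crossCov E d d' * vecMulVec a' (star a))
        + trace (crossCov E d d' * crossCov E b' b)) := by
  simp only [affineInner, star_sum, map_sum, Finset.sum_mul_sum, trace, diag_apply, mul_apply,
    ← Finset.sum_add_distrib]
  refine Finset.sum_congr rfl fun i _ => Finset.sum_congr rfl fun j _ => ?_
  rw [hT.map_product_mul_star_product _ _ _ _ (hb i) (hd i) (hb' j) (hd' j)]
  simp only [vecMulVec_apply, crossCov, of_apply, Pi.star_apply]
  ring

theorem map_sum_mul_star (a : ι → ℂ) (hb : ∀ i, b i ∈ T) :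
    E (∑ i, (algebraMap ℂ A (a i) + b i) * star (algebraMap ℂ A (a i) + b i)) =
      trace (vecMulVec a (star a) + crossCov E b b) := by
  rw [← hT.map_affineInner a a hb hb, affineInner]
  simp only [mul_comm]

end IsCircular

end CrossCovariance

/-! ### Independent circular Gaussian vectors are jointly circular -/

section IndependentFamily

variable {Ω : Type*} [MeasurableSpace Ω] {P : Measure Ω} [IsProbabilityMeasure P]

/-- The complex linear combinations of the real and imaginary parts of the coordinates of `z`. -/
def linearFunctionals {V : Type*} [NormedAddCommGroup V] [NormedSpace ℝ V] (P : Measure Ω)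
    [IsFiniteMeasure P] (z : Ω → V) : Submodule ℂ (allMoments P) where
  carrier := {f | ∃ L : V →L[ℝ] ℂ, ∀ ω, (f : Ω → ℂ) ω = L (z ω)}
  add_mem' := by
    rintro f g ⟨L, hL⟩ ⟨L', hL'⟩
    exact ⟨L + L', fun ω => by simp [hL, hL']⟩
  zero_mem' := ⟨0, fun ω => by simp⟩
  smul_mem' := by
    rintro c f ⟨L, hL⟩
    exact ⟨c • L, fun ω => by simp [hL]⟩

section

variable {V : Type*} [NormedAddCommGroup V] [NormedSpace ℝ V] [MeasurableSpace V] [BorelSpace V]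
  [CompleteSpace V] [SecondCountableTopology V] {z : Ω → V}

/-- A complex-valued real-linear functional is `x + i y` with every real combination `s x + t y`
real Gaussian. The moment identities are polynomial in `(s, t)`, so their coefficients can be
compared and `(s, t) = (1, i)` substituted. -/
theorem linearFunctionals_moments (hz : HasGaussianLaw z P) (h0 : ∫ ω, z ω ∂P = 0)
    {f : allMoments P} (hf : f ∈ linearFunctionals P z) :
    expectation P f = 0 ∧ expectation P (f ^ 3) = 0 ∧
      expectation P (f ^ 4) = 3 * expectation P (f ^ 2) ^ 2 := by
  have hmean : ∀ g ∈ linearFunctionals P z, expectation P g = 0 := by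
    rintro g ⟨L, hL⟩
    rw [expectation_apply]
    simp_rw [hL]
    rw [L.integral_comp_comm hz.integrable, h0, map_zero]
  obtain ⟨L, hL⟩ := hf
  let x : allMoments P := (2⁻¹ : ℂ) • (f + star f)
  let y : allMoments P := (-(Complex.I / 2)) • (f - star f)
  have hx : ∀ ω, (x : Ω → ℂ) ω = ((L (z ω)).re : ℂ) := fun ω => by
    simp [x, hL, Complex.ext_iff]; ring
  have hy : ∀ ω, (y : Ω → ℂ) ω = ((L (z ω)).im : ℂ) := fun ω => by
    simp [y, hL, Complex.ext_iff]; ring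
  have hfxy : f = x + Complex.I • y := by
    ext ω
    simp [hx, hy, hL, Complex.ext_iff]
  have key : ∀ s t : ℝ, expectation P (((s : ℂ) • x + (t : ℂ) • y) ^ 3) = 0 ∧
      expectation P (((s : ℂ) • x + (t : ℂ) • y) ^ 4) =
        3 * expectation P (((s : ℂ) • x + (t : ℂ) • y) ^ 2) ^ 2 := by
    intro s t
    let K : V →L[ℝ] ℝ := s • Complex.reCLM.comp L + t • Complex.imCLM.comp L
    have hK : ∀ ω, (((s : ℂ) • x + (t : ℂ) • y : allMoments P) : Ω → ℂ) ω = (K (z ω) : ℂ) := by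
      intro ω
      simp [K, hx, hy]
    have hpow : ∀ n : ℕ, expectation P (((s : ℂ) • x + (t : ℂ) • y) ^ n) =
        ((∫ ω, K (z ω) ^ n ∂P : ℝ) : ℂ) := by
      intro n
      rw [expectation_apply, ← integral_complex_ofReal]
      refine integral_congr_ae (.of_forall fun ω => ?_)
      change (((s : ℂ) • x + (t : ℂ) • y : allMoments P) : Ω → ℂ) ω ^ n = _
      rw [hK]; push_cast; rfl
    have h0K : ∫ ω, K (z ω) ∂P = 0 := by
      rw [K.integral_comp_comm hz.integrable, h0, map_zero]
    obtain ⟨h3, h4⟩ := (hz.map_fun K).moments_of_centered h0K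
    rw [hpow, hpow, hpow, h3, h4]
    push_cast
    simp
  have e2 : ∀ s t : ℂ, expectation P ((s • x + t • y) ^ 2) = s ^ 2 * expectation P (x ^ 2)
      + 2 * s * t * expectation P (x * y) + t ^ 2 * expectation P (y ^ 2) := by
    intro s t
    have : (s • x + t • y) ^ 2 = s ^ 2 • x ^ 2 + (2 * s * t) • (x * y) + t ^ 2 • y ^ 2 := by
      simp only [Algebra.smul_def, map_ofNat, map_mul, map_pow]; ring
    rw [this]; simp only [map_add, map_smul, smul_eq_mul]
  have e3 : ∀ s t : ℂ, expectation P ((s • x + t • y) ^ 3) = s ^ 3 * expectation P (x ^ 3)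
      + 3 * s ^ 2 * t * expectation P (x ^ 2 * y) + 3 * s * t ^ 2 * expectation P (x * y ^ 2)
      + t ^ 3 * expectation P (y ^ 3) := by
    intro s t
    have : (s • x + t • y) ^ 3 = s ^ 3 • x ^ 3 + (3 * s ^ 2 * t) • (x ^ 2 * y)
        + (3 * s * t ^ 2) • (x * y ^ 2) + t ^ 3 • y ^ 3 := by
      simp only [Algebra.smul_def, map_ofNat, map_mul, map_pow]; ring
    rw [this]; simp only [map_add, map_smul, smul_eq_mul]
  have e4 : ∀ s t : ℂ, expectation P ((s • x + t • y) ^ 4) = s ^ 4 * expectation P (x ^ 4)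
      + 4 * s ^ 3 * t * expectation P (x ^ 3 * y) + 6 * s ^ 2 * t ^ 2 * expectation P (x ^ 2 * y ^ 2)
      + 4 * s * t ^ 3 * expectation P (x * y ^ 3) + t ^ 4 * expectation P (y ^ 4) := by
    intro s t
    have : (s • x + t • y) ^ 4 = s ^ 4 • x ^ 4 + (4 * s ^ 3 * t) • (x ^ 3 * y)
        + (6 * s ^ 2 * t ^ 2) • (x ^ 2 * y ^ 2) + (4 * s * t ^ 3) • (x * y ^ 3) + t ^ 4 • y ^ 4 := by
      simp only [Algebra.smul_def, map_ofNat, map_mul, map_pow]; ring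
    rw [this]; simp only [map_add, map_smul, smul_eq_mul]
  have hf' : f = (1 : ℂ) • x + Complex.I • y := by rw [one_smul, ← hfxy]
  simp only [e2, e3, e4] at key
  -- These five real points determine the needed coefficients. The points `(1, ±1)` split even from
  -- odd powers of `t`, and `(1, 2)` separates `x³ y` from `x y³`, which the other points see only
  -- through their sum.
  have k1 := key 1 0
  have k2 := key 0 1
  have k3 := key 1 1
  have k4 := key 1 (-1)
  have k5 := key 1 2
  push_cast at k1 k2 k3 k4 k5
  refine ⟨hmean f ⟨L, hL⟩, ?_, ?_⟩
  · rw [hf', e3]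
    have hI := Complex.I_sq
    have a0 : expectation P (x ^ 3) = 0 := by linear_combination k1.1
    have a3 : expectation P (y ^ 3) = 0 := by linear_combination k2.1
    have a2 : expectation P (x * y ^ 2) = 0 := by
      linear_combination (k3.1 + k4.1) / 6 - a0 / 3
    have a1 : expectation P (x ^ 2 * y) = 0 := by
      linear_combination (k3.1 - k4.1) / 6 - a3 / 3
    rw [a0, a1, a2, a3]; ring
  · rw [hf', e4, e2]
    have a0 : expectation P (x ^ 4) = 3 * expectation P (x ^ 2) ^ 2 := by
      linear_combination k1.2
    have a4 : expectation P (y ^ 4) = 3 * expectation P (y ^ 2) ^ 2 := by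
      linear_combination k2.2
    have a2 : expectation P (x ^ 2 * y ^ 2) =
        expectation P (x ^ 2) * expectation P (y ^ 2) + 2 * expectation P (x * y) ^ 2 := by
      linear_combination (k3.2 + k4.2) / 12 - a0 / 6 - a4 / 6
    have b1 : expectation P (x ^ 3 * y) + expectation P (x * y ^ 3) =
        3 * expectation P (x * y) * (expectation P (x ^ 2) + expectation P (y ^ 2)) := by
      linear_combination (k3.2 - k4.2) / 8
    have a3 : expectation P (x * y ^ 3) = 3 * expectation P (x * y) * expectation P (y ^ 2) := by
      linear_combination (k5.2 - a0 - 16 * a4 - 24 * a2 - 8 * b1) / 24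
    have a1 : expectation P (x ^ 3 * y) = 3 * expectation P (x * y) * expectation P (x ^ 2) := by
      linear_combination b1 - a3
    rw [a0, a1, a2, a3, a4]; ring

end

namespace CellFree

variable {ι : Type*} [Fintype ι] {N : ℕ}

theorem IsComplexGaussian.coord_memLp {z : Ω → Fin N → ℂ} {μ : Fin N → ℂ}
    {R : Matrix (Fin N) (Fin N) ℂ} (hz : IsComplexGaussian P z μ R) (i : Fin N) :
    (fun ω => z ω i) ∈ allMoments P := fun _ hp =>
  HasGaussianLaw.memLp (hz.gaussian.map_fun (ContinuousLinearMap.proj (R := ℝ)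
    (φ := fun _ : Fin N => ℂ) i)) hp

variable {Z : ι → Ω → Fin N → ℂ} {Q : ι → Matrix (Fin N) (Fin N) ℂ}
  (hZ : ∀ s, IsComplexGaussian P (Z s) 0 (Q s))

/-- The coordinates of a complex Gaussian family as elements of the algebra of random variables
with moments of all orders. -/
noncomputable def coord (s : ι) (i : Fin N) : allMoments P :=
  ⟨fun ω => Z s ω i, (hZ s).coord_memLp i⟩

/-- The complex linear combinations of the coordinates. -/
noncomputable def coordSpan : Submodule ℂ (allMoments P) :=
  .span ℂ (Set.range fun si : ι × Fin N => coord hZ si.1 si.2)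

omit [Fintype ι] in
theorem coord_mem (s : ι) (i : Fin N) : coord hZ s i ∈ coordSpan hZ :=
  Submodule.subset_span ⟨(s, i), rfl⟩

omit [Fintype ι] in
theorem expectation_coord_mul_of_ne (hind : iIndepFun Z P) {s t : ι} (hst : s ≠ t) (i j : Fin N) :
    expectation P (coord hZ s i * coord hZ t j) = 0 := by
  have h := (hind.indepFun hst).comp (measurable_pi_apply i) (measurable_pi_apply j)
  have := h.integral_mul_eq_mul_integral (allMoments.integrable (coord hZ s i)).1
    (allMoments.integrable (coord hZ t j)).1
  refine this.trans ?_
  simp [(hZ s).mean]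

omit [Fintype ι] in
theorem crossCov_coord_of_ne (hind : iIndepFun Z P) {s t : ι} (hst : s ≠ t) :
    crossCov (expectation P) (coord hZ s) (coord hZ t) = 0 := by
  ext i j
  have h := (hind.indepFun hst).comp (measurable_pi_apply i)
    (continuous_star.measurable.comp (measurable_pi_apply j) :
      Measurable fun z : Fin N → ℂ => star (z j))
  have := h.integral_mul_eq_mul_integral (allMoments.integrable (coord hZ s i)).1
    (allMoments.integrable (star (coord hZ t j))).1
  refine this.trans ?_
  simp [(hZ s).mean]

omit [Fintype ι] in
theorem crossCov_coord_self (s : ι) :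
    crossCov (expectation P) (coord hZ s) (coord hZ s) = Q s := by
  ext i j
  have := (hZ s).covariance i j
  simp only [Pi.zero_apply, sub_zero] at this
  exact this

/-- Independence makes the whole family jointly Gaussian, so all real-linear functionals of it can
serve as `S` in `IsCircular.of_span`. Pseudo-covariances vanish by assumption within one vector and
by independence between two, hence on the span by bilinearity. -/
theorem isCircular_coordSpan (hind : iIndepFun Z P) :
    IsCircular (expectation P) (coordSpan hZ) := by
  have hG := hind.hasGaussianLaw fun s => (hZ s).gaussian
  have h0 : ∫ ω, (fun s => Z s ω) ∂P = 0 := by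
    ext s i
    rw [eval_integral fun s => hG.integrable.eval s,
      eval_integral fun i => (hZ s).gaussian.integrable.eval i]
    simpa using (hZ s).mean i
  have hS := fun {f} => linearFunctionals_moments (P := P) (f := f) hG h0
  let pr : ι → Fin N → (ι → Fin N → ℂ) →L[ℝ] ℂ := fun s i =>
    (ContinuousLinearMap.proj (R := ℝ) (φ := fun _ : Fin N => ℂ) i).comp
      (ContinuousLinearMap.proj (R := ℝ) (φ := fun _ : ι => Fin N → ℂ) s)
  refine .of_span (S := linearFunctionals P fun ω s => Z s ω) expectation_one expectation_star
    ?_ ?_ (fun f hf => (hS hf).1) (fun f hf => (hS hf).2.1) (fun f hf => (hS hf).2.2) ?_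
  · refine Submodule.span_le.2 ?_
    rintro _ ⟨⟨s, i⟩, rfl⟩
    exact ⟨pr s i, fun ω => rfl⟩
  · intro f hf
    induction hf using Submodule.span_induction with
    | mem f hf =>
      obtain ⟨⟨s, i⟩, rfl⟩ := hf
      exact ⟨Complex.conjCLE.toContinuousLinearMap.comp (pr s i), fun ω => rfl⟩
    | zero => simp
    | add f g _ _ hf hg => rw [star_add]; exact Submodule.add_mem _ hf hg
    | smul c f _ hf => rw [star_smul]; exact Submodule.smul_mem _ _ hf
  · intro f hf g hg
    induction hf, hg using Submodule.span_induction₂ with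
    | mem_mem f g hf hg =>
      obtain ⟨⟨s, i⟩, rfl⟩ := hf
      obtain ⟨⟨t, j⟩, rfl⟩ := hg
      by_cases hst : s = t
      · subst hst
        have := (hZ s).pseudoCovariance i j
        simp only [Pi.zero_apply, sub_zero] at this
        exact this
      · exact expectation_coord_mul_of_ne hZ hind hst i j
    | zero_left => simp
    | zero_right => simp
    | add_left f g h _ _ _ h1 h2 => rw [add_mul, map_add, h1, h2, add_zero]
    | add_right f g h _ _ _ h1 h2 => rw [mul_add, map_add, h1, h2, add_zero]
    | smul_left c f g _ _ h => rw [smul_mul_assoc, map_smul, h, smul_zero]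
    | smul_right c f g _ _ h => rw [mul_smul_comm, map_smul, h, smul_zero]

end CellFree

end IndependentFamily

/-! ### Trace identities behind the closed form -/

namespace CellFree

namespace Network

variable {M N K : ℕ} (net : Network M N K)

theorem star_amp (l : Fin K) : star (net.amp l) = net.amp l := Complex.conj_ofReal _

theorem amp_mul_amp (l : Fin K) : net.amp l * net.amp l = ((net.p l * net.τp ^ 2 : ℝ) : ℂ) := by
  rw [amp, ← Complex.ofReal_mul, mul_mul_mul_comm, Real.mul_self_sqrt (net.p_nonneg l), sq]

theorem star_trace_G (m : Fin M) (k l : Fin K) :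
    star (trace ((net.W m k)ᴴ * net.G m l k)) = trace (net.W m k * net.G m k l) := by
  rw [← trace_conjTranspose, conjTranspose_mul, conjTranspose_conjTranspose, G, G,
    conjTranspose_vecMulVec, star_star, trace_mul_comm]

theorem star_trace_R (m : Fin M) (k l : Fin K) :
    star (trace ((net.W m k)ᴴ * net.R m l * (net.A m k)ᴴ)) =
      trace (net.W m k * net.A m k * net.R m l) := by
  rw [← trace_conjTranspose, conjTranspose_mul, conjTranspose_mul, conjTranspose_conjTranspose,
    conjTranspose_conjTranspose, (net.R_posSemidef m l).isHermitian.eq, ← mul_assoc,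
    trace_mul_comm, mul_assoc]

/-- Both LoS matrices have rank one, so the trace splits into two conjugate scalars. -/
theorem trace_G_mul_G (m : Fin M) (k l : Fin K) :
    trace ((net.W m k)ᴴ * net.G m l l * net.W m k * net.G m k k) =
      trace ((net.W m k)ᴴ * net.G m l k) * star (trace ((net.W m k)ᴴ * net.G m l k)) := by
  rw [star_trace_G]
  simp only [G, mul_vecMulVec, vecMulVec_mul, trace_vecMulVec, vecMulVec_mulVec, smul_dotProduct,
    op_smul_eq_smul, smul_eq_mul, ← dotProduct_mulVec, dotProduct_comm _ (net.W m k *ᵥ _)]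
  rw [mul_comm]

/-- The right side is what the Gaussian moment formula yields at one AP. The first trace in `ε` is
only the LoS part of `|χ|²`; under pilot sharing `χ` gains a second summand, and `ξ` is exactly the
resulting two cross terms and square. -/
theorem ε_add_ξ (m : Fin M) (k l : Fin K) :
    net.ε m k l + (if l ∈ net.P k then net.ξ m k l else 0) =
      net.χ m k l * star (net.χ m k l)
        + (trace (net.G m l l * (net.W m k * net.estCov m k * (net.W m k)ᴴ))
          + trace (net.R m l * (net.W m k * net.G m k k * (net.W m k)ᴴ))
          + trace (net.R m l * (net.W m k * net.estCov m k * (net.W m k)ᴴ))) := by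
  have cyc : ∀ X Y : Matrix (Fin N) (Fin N) ℂ, trace (X * (net.W m k * Y * (net.W m k)ᴴ)) =
      trace ((net.W m k)ᴴ * X * net.W m k * Y) := fun X Y => by
    rw [← mul_assoc, trace_mul_comm]; simp only [mul_assoc]
  have h1 := net.trace_G_mul_G m k l
  have h2 := net.star_trace_G m k l
  have h3 := net.star_trace_R m k l
  have h4 := net.amp_mul_amp l
  rw [cyc, cyc, cyc, ε, h1, estCov, mul_smul_comm, mul_smul_comm, trace_smul, trace_smul,
    smul_eq_mul, smul_eq_mul, χ]
  split_ifs
  · rw [ξ, B, mul_add, trace_add, mul_smul_comm, trace_smul,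
      ← mul_assoc (net.W m k)ᴴ (net.R m l), smul_eq_mul, star_add,
      star_mul', star_amp, ← h2, ← h3]
    generalize trace ((net.W m k)ᴴ * net.R m l * (net.A m k)ᴴ) = y
    have hy : y * star y = ((‖y‖ ^ 2 : ℝ) : ℂ) := by
      rw [Complex.star_def, Complex.mul_conj, Complex.normSq_eq_norm_sq]
    rw [Complex.ofReal_mul, ← h4, ← hy]
    ring
  · ring

/-! ### Second-order statistics of the network -/

section Fading

variable {Ω : Type*} [MeasurableSpace Ω] {Pr : Measure Ω} [IsProbabilityMeasure Pr]
  {h n : Fin M → Fin K → Ω → Fin N → ℂ}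

/-- The covariance matrices of the NLoS components and of the pilot noises seen by UE `k`. -/
noncomputable def fadingCov : (Fin M × Fin K) ⊕ Fin M → Matrix (Fin N) (Fin N) ℂ :=
  Sum.elim (fun ml => net.R ml.1 ml.2)
    (fun _ => ((net.τp * net.σ2 : ℝ) : ℂ) • (1 : Matrix (Fin N) (Fin N) ℂ))

variable {net} (hf : net.IsFading Pr h n) (k : Fin K)

include hf in
omit [IsProbabilityMeasure Pr] in
theorem IsFading.isComplexGaussian (s : (Fin M × Fin K) ⊕ Fin M) :
    IsComplexGaussian Pr
      (Sum.elim (fun ml : Fin M × Fin K => h ml.1 ml.2) (fun m : Fin M => n m k) s) 0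
      (net.fadingCov s) := by
  cases s with
  | inl ml => exact hf.nlos ml.1 ml.2
  | inr m => exact hf.noise m k

/-- The coordinates of the NLoS component `h m l`. -/
noncomputable def nlosVec (m : Fin M) (l : Fin K) : Fin N → allMoments Pr :=
  coord (hf.isComplexGaussian k) (.inl (m, l))

/-- The coordinates of the random part of the despread pilot signal. -/
noncomputable def pilotVec (m : Fin M) : Fin N → allMoments Pr :=
  ∑ l ∈ net.P k, net.amp l • nlosVec hf k m l + coord (hf.isComplexGaussian k) (.inr m)

/-- The coordinates of the random part of the combining vector. -/
noncomputable def combVec (m : Fin M) : Fin N → allMoments Pr :=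
  matSmul (net.W m k * net.A m k) (pilotVec hf k m)

/-- The inner product `v_mkᴴ g_ml`. -/
noncomputable def combinedVar (m : Fin M) (l : Fin K) : allMoments Pr :=
  affineInner (net.W m k *ᵥ net.los m k) (net.los m l) (combVec hf k m) (nlosVec hf k m l)

theorem crossCov_nlosVec (m m' : Fin M) (l l' : Fin K) :
    crossCov (expectation Pr) (nlosVec hf k m l) (nlosVec hf k m' l') =
      if m = m' ∧ l = l' then net.R m l else 0 := by
  split_ifs with hml
  · obtain ⟨rfl, rfl⟩ := hml
    exact crossCov_coord_self _ _
  · exact crossCov_coord_of_ne _ (hf.indep k) (by simpa using hml)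

theorem crossCov_nlosVec_noise (m m' : Fin M) (l : Fin K) :
    crossCov (expectation Pr) (nlosVec hf k m l) (coord (hf.isComplexGaussian k) (.inr m')) = 0 :=
  crossCov_coord_of_ne _ (hf.indep k) (by simp)

theorem crossCov_noise_nlosVec (m m' : Fin M) (l : Fin K) :
    crossCov (expectation Pr) (coord (hf.isComplexGaussian k) (.inr m')) (nlosVec hf k m l) = 0 :=
  crossCov_coord_of_ne _ (hf.indep k) (by simp)

theorem crossCov_noise (m m' : Fin M) :
    crossCov (expectation Pr) (coord (hf.isComplexGaussian k) (.inr m))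
      (coord (hf.isComplexGaussian k) (.inr m')) =
      if m = m' then ((net.τp * net.σ2 : ℝ) : ℂ) • (1 : Matrix (Fin N) (Fin N) ℂ) else 0 := by
  split_ifs with hm
  · subst hm
    exact crossCov_coord_self _ _
  · exact crossCov_coord_of_ne _ (hf.indep k) (by simpa using hm)

/-- Pilot contamination: the pilot signal of UE `k` contains `h m l` only when `l` shares the pilot
of `k`, and then with amplitude `√p_l τ_p`. -/
theorem crossCov_nlosVec_pilotVec (m m' : Fin M) (l : Fin K) :
    crossCov (expectation Pr) (nlosVec hf k m l) (pilotVec hf k m') =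
      if m = m' ∧ l ∈ net.P k then net.amp l • net.R m l else 0 := by
  rw [pilotVec, crossCov_add_right, crossCov_sum_right, crossCov_nlosVec_noise, add_zero]
  simp only [crossCov_smul_right, crossCov_nlosVec, star_amp]
  by_cases hm : m = m' <;> simp [hm]

theorem crossCov_pilotVec (m m' : Fin M) :
    crossCov (expectation Pr) (pilotVec hf k m) (pilotVec hf k m') =
      if m = m' then (net.τp : ℂ) • net.Ψ m k else 0 := by
  nth_rw 1 [pilotVec]
  rw [crossCov_add_left, crossCov_sum_left]
  simp only [crossCov_smul_left, crossCov_nlosVec_pilotVec]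
  rw [pilotVec, crossCov_add_right, crossCov_sum_right, crossCov_noise hf]
  simp only [crossCov_smul_right, crossCov_noise_nlosVec, smul_zero, Finset.sum_const_zero, zero_add]
  split_ifs with hm
  · subst hm
    rw [Ψ, smul_add, Finset.smul_sum]
    congr 1
    · refine Finset.sum_congr rfl fun l hl => ?_
      -- The squared amplitude is `p_l τ_p²`; one factor `τ_p` is pulled out and the other stays
      -- inside `Ψ`.
      rw [if_pos ⟨rfl, hl⟩, smul_smul, smul_smul, amp_mul_amp]
      congr 1; push_cast; ring
    · rw [smul_smul, Complex.ofReal_mul, Complex.ofReal_natCast]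
  · simp [hm]

/-- The UE `k` stays fixed because independence is assumed only for the NLoS components together
with the noises of a single UE. -/
theorem isCircular_fading : IsCircular (expectation Pr) (coordSpan (hf.isComplexGaussian k)) :=
  isCircular_coordSpan _ (hf.indep k)

theorem nlosVec_mem (m : Fin M) (l : Fin K) (i : Fin N) :
    nlosVec hf k m l i ∈ coordSpan (hf.isComplexGaussian k) := coord_mem _ _ _

theorem combVec_mem (m : Fin M) (i : Fin N) :
    combVec hf k m i ∈ coordSpan (hf.isComplexGaussian k) := by
  refine matSmul_mem _ (fun j => ?_) i
  rw [pilotVec, Pi.add_apply, Finset.sum_apply]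
  exact Submodule.add_mem _ (Submodule.sum_mem _ fun l _ =>
    Submodule.smul_mem _ _ (nlosVec_mem hf k m l j)) (coord_mem _ _ _)

theorem crossCov_combVec (m m' : Fin M) :
    crossCov (expectation Pr) (combVec hf k m) (combVec hf k m') =
      if m = m' then net.W m k * net.estCov m k * (net.W m k)ᴴ else 0 := by
  rw [combVec, combVec, crossCov_matSmul_left, crossCov_matSmul_right, crossCov_pilotVec]
  split_ifs with hm
  · subst hm
    simp [estCov, conjTranspose_mul, mul_assoc]
  · simp

theorem expectation_combinedVar (m : Fin M) (l : Fin K) :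
    expectation Pr (combinedVar hf k m l) = net.χ m k l := by
  rw [combinedVar, (isCircular_fading hf k).map_affineInner _ _ (combVec_mem hf k m)
    (nlosVec_mem hf k m l), combVec, crossCov_matSmul_right, crossCov_nlosVec_pilotVec, χ,
    star_mulVec, ← vecMulVec_mul]
  split_ifs with h1 h2 h2
  · rw [trace_mul_comm (net.W m k)ᴴ, B, add_mul, G, conjTranspose_mul, smul_mul_assoc,
      smul_mul_assoc, mul_assoc]
  · exact absurd h1.2 h2
  · exact absurd ⟨rfl, h2⟩ h1
  · rw [zero_mul, add_zero, trace_mul_comm, G]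

/-- Covariances between different APs vanish, so off the diagonal only the product of means
survives. On the diagonal the correction is the variance, read off from `ε_add_ξ`. -/
theorem expectation_combinedVar_mul_star (m m' : Fin M) (l : Fin K) :
    expectation Pr (combinedVar hf k m l * star (combinedVar hf k m' l)) =
      net.χ m k l * star (net.χ m' k l) + if m = m' then
        net.ε m k l + (if l ∈ net.P k then net.ξ m k l else 0) - ((‖net.χ m k l‖ ^ 2 : ℝ) : ℂ)
      else 0 := by
  have hx : net.χ m k l * star (net.χ m k l) = ((‖net.χ m k l‖ ^ 2 : ℝ) : ℂ) := by
    rw [Complex.star_def, Complex.mul_conj, Complex.normSq_eq_norm_sq]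
  have e := (isCircular_fading hf k).map_affineInner_mul_star (net.W m k *ᵥ net.los m k)
    (net.los m l) (net.W m' k *ᵥ net.los m' k) (net.los m' l) (combVec_mem hf k m)
    (nlosVec_mem hf k m l) (combVec_mem hf k m') (nlosVec_mem hf k m' l)
  rw [← combinedVar, ← combinedVar, expectation_combinedVar, expectation_combinedVar,
    crossCov_combVec, crossCov_nlosVec] at e
  rw [e]
  congr 1
  by_cases hm : m = m'
  · subst hm
    rw [if_pos rfl, if_pos ⟨rfl, rfl⟩, if_pos rfl, ε_add_ξ, hx, add_sub_cancel_left, G, G,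
      star_mulVec, ← vecMulVec_mul, ← mul_vecMulVec]
  · simp [hm, Ne.symm hm]

theorem expectation_sum_mul_star (l : Fin K) :
    expectation Pr ((∑ m, combinedVar hf k m l) * star (∑ m, combinedVar hf k m l)) =
      ∑ m, net.ε m k l + (if l ∈ net.P k then ∑ m, net.ξ m k l else 0)
        + ((‖∑ m, net.χ m k l‖ ^ 2 - ∑ m, ‖net.χ m k l‖ ^ 2 : ℝ) : ℂ) := by
  rw [star_sum, Finset.sum_mul_sum]
  simp only [map_sum, expectation_combinedVar_mul_star, Finset.sum_add_distrib,
    Finset.sum_ite_eq, Finset.mem_univ, if_true]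
  rw [← Finset.sum_mul_sum, ← star_sum, Complex.star_def, Complex.mul_conj,
    Complex.normSq_eq_norm_sq, Finset.sum_sub_distrib, Finset.sum_add_distrib]
  have : (∑ m, if l ∈ net.P k then net.ξ m k l else 0) =
      if l ∈ net.P k then ∑ m, net.ξ m k l else 0 := by split_ifs <;> simp
  rw [this]
  push_cast
  ring

/-- The squared norm of the combining vector. -/
noncomputable def combNormSqVar (m : Fin M) : allMoments Pr :=
  ∑ i, (algebraMap ℂ _ ((net.W m k *ᵥ net.los m k) i) + combVec hf k m i)
    * star (algebraMap ℂ _ ((net.W m k *ᵥ net.los m k) i) + combVec hf k m i)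

theorem expectation_combNormSqVar (m : Fin M) :
    expectation Pr (combNormSqVar hf k m) =
      trace ((net.W m k)ᴴ * net.W m k * (net.G m k k + net.estCov m k)) := by
  rw [combNormSqVar, (isCircular_fading hf k).map_sum_mul_star _ (combVec_mem hf k m),
    crossCov_combVec, if_pos rfl, star_mulVec, ← vecMulVec_mul, ← mul_vecMulVec, G, ← add_mul,
    ← mul_add, trace_mul_comm, mul_assoc]

/-! ### Return from the algebra to the integrals of the model -/

theorem combiner_eq (m : Fin M) (ω : Ω) (i : Fin N) :
    net.combiner h n m k ω i = (net.W m k *ᵥ net.los m k) i + (combVec hf k m i : Ω → ℂ) ω := by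
  have h1 : net.pilotSignal h n m k ω - net.pilotMean m k =
      fun i => (pilotVec hf k m i : Ω → ℂ) ω := by
    ext j
    simp [pilotSignal, pilotMean, channel, pilotVec, nlosVec, coord, Finset.sum_apply, amp,
      Finset.sum_add_distrib]
    ring
  rw [combiner, estimate, h1, mulVec_add, mulVec_mulVec, Pi.add_apply]
  congr 1
  simp [combVec, matSmul, mulVec, dotProduct]

theorem combined_eq (m : Fin M) (l : Fin K) :
    net.combined h n m k l = (combinedVar hf k m l : Ω → ℂ) := by
  ext ω
  simp [combined, combinedVar, affineInner, dotProduct, combiner_eq hf, channel, nlosVec, coord]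

theorem combinerNormSq_eq (m : Fin M) (ω : Ω) :
    (net.combinerNormSq h n m k ω : ℂ) = (combNormSqVar hf k m : Ω → ℂ) ω := by
  rw [combinerNormSq, EuclideanSpace.norm_sq_eq]
  simp [combNormSqVar, combiner_eq hf]
  refine Finset.sum_congr rfl fun i _ => ?_
  rw [← map_add, Complex.mul_conj, Complex.normSq_eq_norm_sq, Complex.ofReal_pow]

include hf

theorem integrable_norm_sq_sum_combined (l : Fin K) :
    Integrable (fun ω => ‖∑ m, net.combined h n m k l ω‖ ^ 2) Pr := by
  have := (allMoments.integrable
    ((∑ m, combinedVar hf k m l) * star (∑ m, combinedVar hf k m l))).re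
  refine this.congr (.of_forall fun ω => ?_)
  simp [combined_eq hf, ← map_sum, Complex.mul_conj, Complex.normSq_eq_norm_sq,
    -Complex.ofReal_pow]

theorem integral_norm_sq_sum_combined (l : Fin K) :
    ((∫ ω, ‖∑ m, net.combined h n m k l ω‖ ^ 2 ∂Pr : ℝ) : ℂ) =
      ∑ m, net.ε m k l + (if l ∈ net.P k then ∑ m, net.ξ m k l else 0)
        + ((‖∑ m, net.χ m k l‖ ^ 2 - ∑ m, ‖net.χ m k l‖ ^ 2 : ℝ) : ℂ) := by
  rw [← expectation_sum_mul_star hf, expectation_apply, ← integral_complex_ofReal]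
  refine integral_congr_ae (.of_forall fun ω => ?_)
  simp [combined_eq hf, ← map_sum, Complex.mul_conj, Complex.normSq_eq_norm_sq]

theorem integrable_combinerNormSq (m : Fin M) : Integrable (net.combinerNormSq h n m k) Pr :=
  (allMoments.integrable (combNormSqVar hf k m)).re.congr <| .of_forall fun ω => by
    simp [← combinerNormSq_eq hf]

theorem integral_combinerNormSq (m : Fin M) :
    ((∫ ω, net.combinerNormSq h n m k ω ∂Pr : ℝ) : ℂ) =
      trace ((net.W m k)ᴴ * net.W m k * (net.G m k k + net.estCov m k)) := by
  rw [← expectation_combNormSqVar hf, expectation_apply, ← integral_complex_ofReal]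
  exact integral_congr_ae (.of_forall fun ω => combinerNormSq_eq hf k m ω)

theorem integral_combined (m : Fin M) :
    ∫ ω, net.combined h n m k k ω ∂Pr = trace ((net.W m k)ᴴ * net.Rbar m k) := by
  rw [combined_eq hf, ← expectation_apply, expectation_combinedVar, χ, if_pos (by simp [P]), B, Rbar]

theorem sinr_eq_closedSinr : ((net.sinr Pr h n k : ℝ) : ℂ) = net.closedSinr k := by
  have hl : ∀ l, ((∫ ω, ‖∑ m, net.combined h n m k l ω‖ ^ 2 ∂Pr : ℝ) : ℂ) = _ :=
    integral_norm_sq_sum_combined hf k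
  have hP : ∑ l ∈ net.P k, ∑ m, (net.p l : ℂ) * net.ξ m k l =
      ∑ l, (net.p l : ℂ) * (if l ∈ net.P k then ∑ m, net.ξ m k l else 0) := by
    simp [Finset.mul_sum, Finset.sum_ite_mem]
  rw [sinr, closedSinr, closedSinrWith]
  simp only [integral_combined hf]
  -- Numerators and denominators are matched separately, so a zero denominator needs no case
  -- distinction: both quotients are then `0`.
  rw [Complex.ofReal_div]
  congr 1
  rw [Complex.ofReal_add, Complex.ofReal_sub, Complex.ofReal_sum, hP, Complex.ofReal_sum,
    Complex.ofReal_mul net.σ2, Complex.ofReal_sum, ← Finset.sum_add_distrib,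
    ← Finset.sum_add_distrib]
  simp only [integral_combinerNormSq hf]
  congr 2
  refine Finset.sum_congr rfl fun l _ => ?_
  rw [Complex.ofReal_mul, hl, Complex.ofReal_mul, ← Finset.mul_sum]
  ring

end Fading

/-- Multiplied by `τ_p`, the hypothesis says that the covariance of the channel with its estimate
equals the covariance of the estimate, i.e. the estimation error is uncorrelated with the estimate.
-/
theorem closedSinrRbar_eq_closedSinr (k : Fin K)
    (hA : ∀ m, ((√(net.p k) : ℝ) : ℂ) • (net.R m k * (net.A m k)ᴴ) =
      net.A m k * net.Ψ m k * (net.A m k)ᴴ) :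
    net.closedSinrRbar k = net.closedSinr k := by
  have : (fun m => net.Rbar m k) = fun m => net.G m k k + net.estCov m k := by
    funext m
    rw [Rbar, estCov, ← hA, smul_smul, amp, Complex.ofReal_mul, Complex.ofReal_natCast, mul_comm]
  rw [closedSinrRbar, closedSinr, this]

end Network

end CellFree

theorem theorem1 {M N K : ℕ} (net : CellFree.Network M N K)
    {Ω : Type*} [MeasurableSpace Ω] (Pr : MeasureTheory.Measure Ω)
    [MeasureTheory.IsProbabilityMeasure Pr]
    (h n : Fin M → Fin K → Ω → Fin N → ℂ) (hfading : net.IsFading Pr h n) (k : Fin K) :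
    -- all expectations in the SINR exist
    (∀ m, MeasureTheory.Integrable (net.combined h n m k k) Pr) ∧
    (∀ l, MeasureTheory.Integrable (fun ω => ‖∑ m, net.combined h n m k l ω‖ ^ 2) Pr) ∧
    (∀ m, MeasureTheory.Integrable (net.combinerNormSq h n m k) Pr) ∧
    -- closed form of the SINR and of the spectral efficiency
    ((net.sinr Pr h n k : ℝ) : ℂ) = net.closedSinr k ∧
    net.se (net.sinr Pr h n k) = net.se (net.closedSinr k).re ∧
    -- the noise term simplifies for estimators with `√p_k Ř_mk A_mkᴴ = A_mk Ψ_mk A_mkᴴ`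
    ((∀ m, ((√(net.p k) : ℝ) : ℂ) • (net.R m k * (net.A m k).conjTranspose)
          = net.A m k * net.Ψ m k * (net.A m k).conjTranspose) →
      ((net.sinr Pr h n k : ℝ) : ℂ) = net.closedSinrRbar k ∧
      net.se (net.sinr Pr h n k) = net.se (net.closedSinrRbar k).re) := by
  have hs := CellFree.Network.sinr_eq_closedSinr hfading k
  have hse : net.se (net.sinr Pr h n k) = net.se (net.closedSinr k).re := by
    rw [← hs, Complex.ofReal_re]
  refine ⟨fun m => ?_, CellFree.Network.integrable_norm_sq_sum_combined hfading k,
    CellFree.Network.integrable_combinerNormSq hfading k, hs, hse, fun hA => ?_⟩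
  · rw [CellFree.Network.combined_eq hfading]
    exact allMoments.integrable _
  · rw [net.closedSinrRbar_eq_closedSinr k hA]
    exact ⟨hs, hse⟩
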